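/- A group $G$ is $\mathfrak{M}_C$ if there is no infinite strictly descending sequence $C_G(A_0)>C_G(A_1)>\cdots$ of centralizers of subsets $A_n\subseteq G$; it has finite centralizer dimension (fcd) if there is a uniform bound $n\ge 1$ on the lengths $k$ of chains $G=C_G(1)>C_G(A_1)>\cdots>C_G(A_k)$ of centralizers of subsets $A_i\subseteq G$. The Fitting subgroup $F(G)$ is the subgroup generated by all normal nilpotent subgroups of $G$. Definability refers to first-order formulas in the language of groups, and $\mathrm{Th}(G)$ is the complete theory of $G$ in this language. Let $G$ be an $\mathfrak{M}_C$ group. Then $F(G)$ coincides with an $\emptyset$-definable (that is, definable without parameters) nilpotent subgroup of $G$. If moreover $G$ has finite centralizer dimension, then $F(G)$ is $\emptyset$-definable uniformly in $\mathrm{Th}(G)$: there is a single formula $\varphi(x)$ without parameters such that $F(G')=\{g\in G' : G'\models\varphi(g)\}$ for every model $G'$ of $\mathrm{Th}(G)$ (in particular for $G'=G$). -/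

import Mathlib

universe u v

namespace MCGroup

/-- The function symbols of the language of groups: multiplication, inverse and identity. -/
inductive GroupFunc : ℕ → Type
  | mul : GroupFunc 2
  | inv : GroupFunc 1
  | one : GroupFunc 0

/-- The first-order language of groups. It has no relation symbols (besides equality). -/
def groupLang : FirstOrder.Language where
  Functions := GroupFunc
  Relations := fun _ => Empty

/-- Every group is a structure for the language of groups, in the standard way. -/
instance groupStructure (G : Type*) [Group G] : groupLang.Structure G where
  funMap := fun {_} f =>
    match f with
    | .mul => fun x => x 0 * x 1
    | .inv => fun x => (x 0)⁻¹
    | .one => fun _ => 1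
  RelMap := fun r _ => nomatch r

/-- The chain condition on centralizers: there is no infinite strictly descending sequence
`C_G(A 0) > C_G(A 1) > ...` of centralizers of subsets of `G`. -/
def IsMC (G : Type*) [Group G] : Prop :=
  ¬ ∃ A : ℕ → Set G,
    ∀ n, Subgroup.centralizer (A (n + 1)) < Subgroup.centralizer (A n)

/-- Finite centralizer dimension: there is a uniform bound `n` on the length `k` of the chains
`G = C_G(1) > C_G(A 1) > ... > C_G(A k)` of centralizers of subsets of `G`. -/
def HasFCD (G : Type*) [Group G] : Prop :=
  ∃ n : ℕ, 1 ≤ n ∧ ∀ (k : ℕ) (A : Fin (k + 1) → Set G), A 0 = {1} →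
    StrictAnti (fun i => Subgroup.centralizer (A i)) → k ≤ n

/-- The Fitting subgroup: the subgroup generated by all normal nilpotent subgroups. -/
def fitting (G : Type*) [Group G] : Subgroup G :=
  sSup {H : Subgroup G | H.Normal ∧ Group.IsNilpotent H}

end MCGroup

/-! By Fitting's theorem, every finite subset of F(G) lies in a nilpotent normal subgroup. An `IsMC`
group with this local property is nilpotent (`isNilpotent_of_isLocallyNormalNilpotent`):
centralizers are determined by finite sets, and the centralizers of the lower central terms
stabilize inside a finite term of the upper central series. Since `IsMC` passes to subgroups, F(G)
is nilpotent.

If the n-th lower central term of F(G) is trivial, then g lies in F(G) exactly when every commutator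
of g with n of its conjugates is trivial (`mem_fitting_iff_conjCommutator`), which is a first-order
condition on g.

Under fcd, a sentence of Th(G) bounds centralizer chains, so each model G' is `IsMC` and F(G') is
nilpotent, perhaps with a larger bound m. That the formula for max(m, n) implies the one for n is a
sentence true in G, hence in G', so n serves for G' too. -/

open Subgroup
open scoped commutatorElement
namespace MCGroup

/-! ### Commutator calculus. -/

section Commutators

variable {G : Type*} [Group G]

/-- Modulo a normal subgroup `W`, the subgroups `H` and `K` commute if and only if the image of `H`
centralizes the image of `K`. -/
theorem commutator_le_iff_le_comap_centralizer (H K W : Subgroup G) [W.Normal] :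
    ⁅H, K⁆ ≤ W ↔
      H ≤ (centralizer (K.map (QuotientGroup.mk' W) : Set (G ⧸ W))).comap
        (QuotientGroup.mk' W) := by
  rw [← map_le_iff_le_comap, ← commutator_eq_bot_iff_le_centralizer, ← map_commutator,
    Subgroup.map_eq_bot_iff, QuotientGroup.ker_mk']

theorem iSup_commutator_le {ι : Sort*} {X : ι → Subgroup G} {K W : Subgroup G} [W.Normal]
    (h : ∀ i, ⁅X i, K⁆ ≤ W) : ⁅⨆ i, X i, K⁆ ≤ W := by
  rw [commutator_le_iff_le_comap_centralizer]
  exact iSup_le fun i => (commutator_le_iff_le_comap_centralizer _ _ _).1 (h i)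

theorem commutator_sup_le {X A B W : Subgroup G} [W.Normal]
    (hA : ⁅X, A⁆ ≤ W) (hB : ⁅X, B⁆ ≤ W) : ⁅X, A ⊔ B⁆ ≤ W := by
  rw [commutator_comm, commutator_le_iff_le_comap_centralizer]
  rw [commutator_comm, commutator_le_iff_le_comap_centralizer] at hA hB
  exact sup_le hA hB

/-- The three subgroups lemma modulo a normal subgroup. -/
theorem commutator_commutator_le_of_rotate {A B C W : Subgroup G} [W.Normal]
    (h1 : ⁅⁅B, C⁆, A⁆ ≤ W) (h2 : ⁅⁅C, A⁆, B⁆ ≤ W) : ⁅⁅A, B⁆, C⁆ ≤ W := by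
  have key : ∀ X : Subgroup G, X ≤ W ↔ X.map (QuotientGroup.mk' W) = ⊥ := fun X => by
    rw [Subgroup.map_eq_bot_iff, QuotientGroup.ker_mk']
  rw [key, map_commutator, map_commutator] at h1 h2 ⊢
  exact commutator_commutator_eq_bot_of_rotate h1 h2

theorem upperCentralSeries_commutator_le (m : ℕ) (K : Subgroup G) :
    ⁅Subgroup.upperCentralSeries G m, K⁆ ≤ Subgroup.upperCentralSeries G (m - 1) := by
  cases m with
  | zero => simp [Subgroup.upperCentralSeries_zero]
  | succ m =>
    exact (commutator_mono le_rfl le_top).trans (commutator_upperCentralSeries_top_le G m)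

theorem commutator_le_upperCentralSeries_iff {m : ℕ} {X : Subgroup G} :
    ⁅X, (⊤ : Subgroup G)⁆ ≤ Subgroup.upperCentralSeries G m ↔ X ≤ Subgroup.upperCentralSeries G (m + 1) := by
  rw [commutator_le]
  exact ⟨fun h x hx y => h x hx y (mem_top y), fun h x hx y _ => h hx y⟩

/-- If `N` moves `E` into the `m`-th centre, then the lower central series of `N` moves `E` down the
upper central series of the whole group. -/
theorem commutator_lowerCentralSeries_le {E N : Subgroup G} {m : ℕ}
    (h : ⁅E, N⁆ ≤ Subgroup.upperCentralSeries G m) (k : ℕ) :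
    ⁅E, N.lowerCentralSeries k⁆ ≤ Subgroup.upperCentralSeries G (m - k) := by
  induction k generalizing E m with
  | zero => simpa using h
  | succ k ih =>
    rw [Subgroup.lowerCentralSeries_succ, commutator_comm]
    apply commutator_commutator_le_of_rotate
    · rw [commutator_comm N E]
      -- The induction hypothesis is applied to `⁅E, N⁆`, which `N` moves into the centre of index
      -- `m - 1`.
      refine (ih (m := m - 1) ?_).trans (by rw [Nat.sub_sub, add_comm])
      exact (commutator_mono h le_rfl).trans (upperCentralSeries_commutator_le m N)
    · refine (commutator_mono (ih h) le_rfl).trans ?_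
      exact (upperCentralSeries_commutator_le _ N).trans (by rw [Nat.sub_sub])

/-- On an abelian normal subgroup centralized by `⁅z⁻¹, g⁆`, conjugations by `z` and `g` commute,
hence so do the maps `a ↦ ⁅a, z⁆` and `a ↦ ⁅a, g⁆`. -/
theorem commutatorElement_right_comm {a z g : G}
    (h₁ : Commute ⁅z⁻¹, g⁆ (g * a * g⁻¹))
    (h₂ : Commute (g * a * g⁻¹)⁻¹ (z * (g * a * g⁻¹ * a⁻¹) * z⁻¹))
    (h₃ : Commute a (g * a * g⁻¹)) :
    ⁅⁅a, g⁆, z⁆ = ⁅⁅a, z⁆, g⁆ := by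
  have e₁ : g * z * a * z⁻¹ * g⁻¹ = z * (g * a * g⁻¹) * z⁻¹ := by
    have h := h₁.eq
    calc g * z * a * z⁻¹ * g⁻¹
        = z * (⁅z⁻¹, g⁆ * (g * a * g⁻¹)) * (g * z⁻¹ * g⁻¹) := by
          simp only [commutatorElement_def]; group
      _ = z * (g * a * g⁻¹) * z⁻¹ := by
          rw [h]; simp only [commutatorElement_def]; group
  calc ⁅⁅a, g⁆, z⁆ = a * ((g * a * g⁻¹)⁻¹ * (z * (g * a * g⁻¹ * a⁻¹) * z⁻¹)) := by
        simp only [commutatorElement_def]; group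
    _ = a * ((z * (a⁻¹ * (g * a * g⁻¹)) * z⁻¹) * (g * a * g⁻¹)⁻¹) := by
        rw [h₂.eq, h₃.inv_left.eq]
    _ = a * (z * a⁻¹ * z⁻¹) * (z * (g * a * g⁻¹) * z⁻¹) * (g * a * g⁻¹)⁻¹ := by group
    _ = ⁅⁅a, z⁆, g⁆ := by rw [← e₁]; simp only [commutatorElement_def]; group

end Commutators

/-! ### Fitting's theorem and the local structure of F(G). -/

section Fitting

variable {G : Type*} [Group G]

/-- The lower central series of `A`, preceded by the whole group. -/
def extendedLowerSeries (A : Subgroup G) : ℕ → Subgroup G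
  | 0 => ⊤
  | i + 1 => A.lowerCentralSeries i

instance extendedLowerSeries_normal (A : Subgroup G) [A.Normal] (i : ℕ) :
    (extendedLowerSeries A i).Normal := by
  cases i with
  | zero => exact inferInstanceAs (⊤ : Subgroup G).Normal
  | succ i => exact Subgroup.lowerCentralSeries_normal A i

theorem extendedLowerSeries_commutator_le (A : Subgroup G) [A.Normal] (i : ℕ) :
    ⁅extendedLowerSeries A i, A⁆ ≤ extendedLowerSeries A (i + 1) := by
  cases i with
  | zero => exact commutator_le_right _ _
  | succ i => exact le_rfl

theorem lowerCentralSeries_sup_le (A B : Subgroup G) [A.Normal] [B.Normal] (n : ℕ) :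
    (A ⊔ B).lowerCentralSeries n ≤
      ⨆ p : {p : ℕ × ℕ // p.1 + p.2 = n + 1},
        extendedLowerSeries A p.1.1 ⊓ extendedLowerSeries B p.1.2 := by
  induction n with
  | zero =>
    refine sup_le ?_ ?_
    · exact le_iSup_of_le ⟨(1, 0), rfl⟩ (le_inf le_rfl le_top)
    · exact le_iSup_of_le ⟨(0, 1), rfl⟩ (le_inf le_top le_rfl)
  | succ n ih =>
    rw [Subgroup.lowerCentralSeries_succ]
    refine (commutator_mono ih le_rfl).trans (iSup_commutator_le ?_)
    rintro ⟨⟨i, j⟩, hij⟩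
    apply commutator_sup_le
    · refine le_iSup_of_le ⟨(i + 1, j), by simp only at hij ⊢; omega⟩ (le_inf ?_ ?_)
      · exact (commutator_mono inf_le_left le_rfl).trans (extendedLowerSeries_commutator_le A i)
      · exact (commutator_mono inf_le_right le_rfl).trans (commutator_le_left _ _)
    · refine le_iSup_of_le ⟨(i, j + 1), by simp only at hij ⊢; omega⟩ (le_inf ?_ ?_)
      · exact (commutator_mono inf_le_left le_rfl).trans (commutator_le_left _ _)
      · exact (commutator_mono inf_le_right le_rfl).trans (extendedLowerSeries_commutator_le B j)

/-- **Fitting's theorem**. -/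
theorem isNilpotent_sup {A B : Subgroup G} [A.Normal] [B.Normal]
    (hA : Group.IsNilpotent A) (hB : Group.IsNilpotent B) :
    Group.IsNilpotent (A ⊔ B : Subgroup G) := by
  obtain ⟨a, ha⟩ := (isNilpotent_iff_lowerCentralSeries A).1 hA
  obtain ⟨b, hb⟩ := (isNilpotent_iff_lowerCentralSeries B).1 hB
  -- Here `i + j = a + b + 2`, so `i > a` or `j > b`, and one factor of the intersection is trivial.
  refine isNilpotent_of_lowerCentralSeries_eq_bot (n := a + b + 1) (eq_bot_iff.2 ?_)
  refine (lowerCentralSeries_sup_le A B _).trans (iSup_le ?_)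
  rintro ⟨⟨i, j⟩, hij⟩
  simp only at hij
  rcases Nat.lt_or_ge a i with h | h
  · obtain ⟨i, rfl⟩ : ∃ k, i = k + 1 := ⟨i - 1, by omega⟩
    exact inf_le_left.trans ((Subgroup.lowerCentralSeries_antitone A (by omega : a ≤ i)).trans ha.le)
  · obtain ⟨j, rfl⟩ : ∃ k, j = k + 1 := ⟨j - 1, by omega⟩
    exact inf_le_right.trans ((Subgroup.lowerCentralSeries_antitone B (by omega : b ≤ j)).trans hb.le)

theorem mem_fitting_iff {g : G} :
    g ∈ fitting G ↔ ∃ N : Subgroup G, N.Normal ∧ Group.IsNilpotent N ∧ g ∈ N := by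
  have hne : {H : Subgroup G | H.Normal ∧ Group.IsNilpotent H}.Nonempty :=
    ⟨⊥, inferInstance, inferInstance⟩
  have hdir : DirectedOn (· ≤ ·) {H : Subgroup G | H.Normal ∧ Group.IsNilpotent H} := by
    rintro A ⟨hA, hA'⟩ B ⟨hB, hB'⟩
    exact ⟨A ⊔ B, ⟨inferInstance, isNilpotent_sup hA' hB'⟩, le_sup_left, le_sup_right⟩
  rw [fitting, mem_sSup_of_directedOn hne hdir]
  simp only [Set.mem_ofPred_eq, and_assoc]

theorem le_fitting {N : Subgroup G} (hN : N.Normal) (hN' : Group.IsNilpotent N) :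
    N ≤ fitting G :=
  le_sSup ⟨hN, hN'⟩

instance fitting_normal : (fitting G).Normal where
  conj_mem g hg x := by
    obtain ⟨N, hN, hN', hgN⟩ := mem_fitting_iff.1 hg
    exact mem_fitting_iff.2 ⟨N, hN, hN', hN.conj_mem g hgN x⟩

/-- Every finite subset of `G` lies in a normal nilpotent subgroup. -/
def IsLocallyNormalNilpotent (G : Type*) [Group G] : Prop :=
  ∀ S : Set G, S.Finite → ∃ N : Subgroup G, N.Normal ∧ Group.IsNilpotent N ∧ S ⊆ N

theorem isLocallyNormalNilpotent_of_forall_mem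
    (h : ∀ g : G, ∃ N : Subgroup G, N.Normal ∧ Group.IsNilpotent N ∧ g ∈ N) :
    IsLocallyNormalNilpotent G := by
  intro S hS
  induction S, hS using Set.Finite.induction_on with
  | empty => exact ⟨⊥, inferInstance, inferInstance, Set.empty_subset _⟩
  | insert _ _ ih =>
    rename_i g S _ _
    obtain ⟨N, hN, hN', hSN⟩ := ih
    obtain ⟨M, hM, hM', hgM⟩ := h g
    refine ⟨M ⊔ N, inferInstance, isNilpotent_sup hM' hN', Set.insert_subset ?_ ?_⟩
    · exact mem_sup_left hgM
    · exact hSN.trans (le_sup_right : N ≤ M ⊔ N)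

theorem isLocallyNormalNilpotent_fitting : IsLocallyNormalNilpotent (fitting G) := by
  refine isLocallyNormalNilpotent_of_forall_mem fun g => ?_
  obtain ⟨N, hN, hN', hgN⟩ := mem_fitting_iff.1 g.2
  refine ⟨N.subgroupOf (fitting G), inferInstance, ?_, hgN⟩
  exact (Group.isNilpotent_congr (subgroupOfEquivOfLe (le_fitting hN hN'))).2 hN'

end Fitting

/-! ### Consequences of the chain condition. -/

section ChainCondition

variable {G : Type*} [Group G]

theorem IsMC.exists_minimal (hG : IsMC G) {P : Set G → Prop} (hP : ∃ S, P S) :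
    ∃ S, P S ∧ ∀ T, P T → ¬ centralizer T < centralizer S := by
  by_contra! h
  obtain ⟨S₀, hS₀⟩ := hP
  choose! f hf hlt using h
  have hPn : ∀ n, P (f^[n] S₀) := fun n => by
    induction n with
    | zero => exact hS₀
    | succ n ih => rw [Function.iterate_succ_apply']; exact hf _ ih
  refine hG ⟨fun n => f^[n] S₀, fun n => ?_⟩
  simp only [Function.iterate_succ_apply']
  exact hlt _ (hPn n)

theorem IsMC.exists_finite_centralizer_eq (hG : IsMC G) (S : Set G) :
    ∃ T ⊆ S, T.Finite ∧ centralizer T = centralizer S := by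
  obtain ⟨T, ⟨hTS, hT⟩, hmin⟩ := hG.exists_minimal (P := fun T => T ⊆ S ∧ T.Finite)
    ⟨∅, Set.empty_subset S, Set.finite_empty⟩
  refine ⟨T, hTS, hT, le_antisymm (fun x hx s hs => ?_) (centralizer_le hTS)⟩
  have hle : centralizer (insert s T) ≤ centralizer T := centralizer_le (Set.subset_insert s T)
  have heq := eq_of_le_of_not_lt hle (hmin _ ⟨Set.insert_subset hs hTS, hT.insert s⟩)
  rw [← heq] at hx
  exact hx s (Set.mem_insert s T)

/-- The centralizers of the `K j` ascend, so the chain condition is applied to the double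
centralizers; a triple centralizer is a single one. -/
theorem IsMC.exists_centralizer_stable (hG : IsMC G) {K : ℕ → Subgroup G} (hK : Antitone K) :
    ∃ r, ∀ j, r ≤ j → centralizer (K j : Set G) = centralizer (K r : Set G) := by
  obtain ⟨S, ⟨r, rfl⟩, hmin⟩ := hG.exists_minimal
    (P := fun S => ∃ r, S = (centralizer (K r : Set G) : Set G)) ⟨_, 0, rfl⟩
  refine ⟨r, fun j hj => ?_⟩
  have hle : centralizer (K r : Set G) ≤ centralizer (K j : Set G) := centralizer_le (hK hj)
  have heq := eq_of_le_of_not_lt (centralizer_le hle) (hmin _ ⟨j, rfl⟩)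
  refine le_antisymm ?_ hle
  rw [le_centralizer_iff]
  refine le_trans ?_ heq.ge
  rw [le_centralizer_iff]

theorem IsMC.subgroup (hG : IsMC G) (H : Subgroup G) : IsMC H := by
  rintro ⟨A, hA⟩
  have key : ∀ (S : Set H) (x : H),
      x ∈ centralizer S ↔ (x : G) ∈ centralizer (H.subtype '' S) := by
    intro S x
    simp only [mem_centralizer_iff, Set.forall_mem_image, Subtype.ext_iff]
    rfl
  -- Descent of centralizers in `H` need not give descent in `G`; replacing `A n` by the union of
  -- the sets up to `n` forces it without changing centralizers in `H`.
  have hlt : ∀ n, centralizer (H.subtype '' ⋃ i ∈ Set.Iic (n + 1), A i) <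
      centralizer (H.subtype '' ⋃ i ∈ Set.Iic n, A i) := by
    have hanti : Antitone fun n => centralizer (A n) := antitone_nat_of_succ_le fun n => (hA n).le
    have hU : ∀ n, centralizer (⋃ i ∈ Set.Iic n, A i) = centralizer (A n) := by
      intro n
      refine le_antisymm (centralizer_le (Set.subset_biUnion_of_mem (Set.mem_Iic.2 le_rfl))) ?_
      intro x hx y hy
      simp only [Set.mem_iUnion] at hy
      obtain ⟨i, hi, hy⟩ := hy
      exact hanti (Set.mem_Iic.1 hi) hx y hy
    intro n
    obtain ⟨x, hx, hx'⟩ := SetLike.exists_of_lt (hA n)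
    refine SetLike.lt_iff_le_and_exists.2
      ⟨centralizer_le (Set.image_mono ?_), (x : G), ?_, ?_⟩
    · exact Set.biUnion_subset_biUnion_left (Set.Iic_subset_Iic.2 n.le_succ)
    · rwa [← key, hU]
    · rwa [← key, hU]
  exact hG ⟨fun n => H.subtype '' ⋃ i ∈ Set.Iic n, A i, hlt⟩

end ChainCondition

/-! ### Nilpotency from local nilpotency. -/

section LocallyNormalNilpotent

variable {G : Type*} [Group G]

theorem exists_mem_lowerCentralSeries {j : ℕ} {x : G}
    (hx : x ∈ (⊤ : Subgroup G).lowerCentralSeries j) :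
    ∃ S : Set G, S.Finite ∧ ∀ N : Subgroup G, S ⊆ N → x ∈ N.lowerCentralSeries j := by
  induction j generalizing x with
  | zero => exact ⟨{x}, Set.finite_singleton x, fun N hN => hN rfl⟩
  | succ j ih =>
    rw [Subgroup.lowerCentralSeries_succ, Subgroup.commutator_def] at hx
    induction hx using closure_induction with
    | mem x hx =>
      obtain ⟨y, hy, z, -, rfl⟩ := hx
      obtain ⟨S, hS, hSN⟩ := ih hy
      refine ⟨insert z S, hS.insert z, fun N hN => ?_⟩
      exact commutator_mem_commutator (hSN N ((Set.subset_insert z S).trans hN))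
        (hN (Set.mem_insert z S))
    | one => exact ⟨∅, Set.finite_empty, fun N _ => one_mem _⟩
    | mul x y _ _ hx hy =>
      obtain ⟨S, hS, hSN⟩ := hx
      obtain ⟨T, hT, hTN⟩ := hy
      exact ⟨S ∪ T, hS.union hT, fun N hN => mul_mem
        (hSN N (Set.subset_union_left.trans hN)) (hTN N (Set.subset_union_right.trans hN))⟩
    | inv x _ hx =>
      obtain ⟨S, hS, hSN⟩ := hx
      exact ⟨S, hS, fun N hN => inv_mem (hSN N hN)⟩

theorem exists_centralizer_lowerCentralSeries_eq (hG : IsMC G) (hF : IsLocallyNormalNilpotent G)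
    (j : ℕ) : ∃ N : Subgroup G, N.Normal ∧ Group.IsNilpotent N ∧
      centralizer (N.lowerCentralSeries j : Set G) =
        centralizer ((⊤ : Subgroup G).lowerCentralSeries j : Set G) := by
  obtain ⟨T, hTS, hT, hTC⟩ :=
    hG.exists_finite_centralizer_eq ((⊤ : Subgroup G).lowerCentralSeries j : Set G)
  choose! S hS hSN using fun x (hx : x ∈ T) => exists_mem_lowerCentralSeries (hTS hx)
  obtain ⟨N, hN, hN', hNS⟩ := hF (⋃ x ∈ T, S x) (hT.biUnion hS)
  refine ⟨N, hN, hN', le_antisymm ?_ (centralizer_le (Subgroup.lowerCentralSeries_mono j le_top))⟩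
  rw [← hTC]
  exact centralizer_le fun x hx => hSN x hx N ((Set.subset_biUnion_of_mem hx).trans hNS)

/-- An abelian normal subgroup that is centralized by a term of the lower central series lies in a
term of the upper central series. -/
theorem exists_le_upperCentralSeries_of_centralizes (hG : IsMC G)
    (hF : IsLocallyNormalNilpotent G) (r : ℕ) (A : Subgroup G) [A.Normal]
    (hA : A ≤ centralizer (A : Set G))
    (hr : A ≤ centralizer ((⊤ : Subgroup G).lowerCentralSeries r : Set G)) :
    ∃ s, A ≤ Subgroup.upperCentralSeries G s := by
  induction r generalizing A with
  | zero =>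
    refine ⟨1, ?_⟩
    rw [Subgroup.upperCentralSeries_one, ← centralizer_univ]
    simpa using hr
  | succ r ih =>
    set L : Subgroup G := (⊤ : Subgroup G).lowerCentralSeries r with hL
    obtain ⟨s, hs⟩ := ih (A ⊓ centralizer (L : Set G))
      (inf_le_left.trans (hA.trans (centralizer_le inf_le_left))) inf_le_right
    obtain ⟨T, hTL, hT, hTC⟩ := hG.exists_finite_centralizer_eq (L : Set G)
    obtain ⟨M, hM, hM', hTM⟩ := hF T hT
    have hswap : ∀ a ∈ A, ∀ z ∈ L, ∀ g : G, ⁅⁅a, g⁆, z⁆ = ⁅⁅a, z⁆, g⁆ := by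
      intro a ha z hz g
      have hb : g * a * g⁻¹ ∈ A := Normal.conj_mem inferInstance a ha g
      refine commutatorElement_right_comm ?_ ?_ ?_
      · exact hr hb _ (commutator_mem_commutator (inv_mem hz) (mem_top g))
      · refine (hA (Normal.conj_mem inferInstance _ (mul_mem hb (inv_mem ha)) z) _ (inv_mem hb))
      · exact hA hb a ha
    -- By `hswap` the hypothesis passes from `a` to `⁅a, g⁆` with `q` lowered by one; at `q = 0`,
    -- `a` centralizes `T`, hence `L`, and `hs` applies.
    have hstep : ∀ q, ∀ a ∈ A, (∀ z ∈ T, ⁅a, z⁆ ∈ Subgroup.upperCentralSeries G q) →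
        a ∈ Subgroup.upperCentralSeries G (q + s) := by
      intro q
      induction q with
      | zero =>
        intro a ha haz
        rw [zero_add]
        refine hs (mem_inf.2 ⟨ha, ?_⟩)
        rw [← hTC, mem_centralizer_iff_commutator_eq_one']
        exact fun z hz => by simpa [Subgroup.upperCentralSeries_zero] using haz z hz
      | succ q ihq =>
        intro a ha haz
        rw [add_right_comm]
        intro g
        refine ihq _ ?_ fun z hz => ?_
        · exact commutator_le_left A ⊤ (commutator_mem_commutator ha (mem_top g))
        · rw [hswap a ha z (hTL hz) g]
          exact haz z hz g
    obtain ⟨c, hc⟩ := (isNilpotent_iff_lowerCentralSeries M).1 hM'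
    -- Commuting with `T ⊆ M` lowers the position in the lower central series of `M`, so `hstep`
    -- climbs from the trivial term up to `M`.
    have hdown : ∀ t ≤ c, ∃ q, A ⊓ M.lowerCentralSeries (c - t) ≤ Subgroup.upperCentralSeries G q := by
      intro t
      induction t with
      | zero => exact fun _ => ⟨0, by simp [hc]⟩
      | succ t iht =>
        intro ht
        obtain ⟨q, hq⟩ := iht (by omega)
        refine ⟨q + s, fun a ha => hstep q a ha.1 fun z hz => hq ⟨?_, ?_⟩⟩
        · exact commutator_le_left A ⊤ (commutator_mem_commutator ha.1 (mem_top z))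
        · rw [show c - t = c - (t + 1) + 1 by omega]
          exact commutator_mem_commutator ha.2 (hTM hz)
    obtain ⟨q, hq⟩ := hdown c le_rfl
    refine ⟨q + s, fun a ha => hstep q a ha fun z hz => hq ⟨?_, ?_⟩⟩
    · exact commutator_le_left A ⊤ (commutator_mem_commutator ha (mem_top z))
    · rw [Nat.sub_self, Subgroup.lowerCentralSeries_zero]
      exact commutator_le_right A M (commutator_mem_commutator ha (hTM hz))

/-- The intersection of the term with its centralizer is abelian, so the preceding result applies to
it; each step up the lower central series then costs one more centre. -/
theorem exists_centralizer_lowerCentralSeries_le (hG : IsMC G) (hF : IsLocallyNormalNilpotent G)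
    (r : ℕ) : ∃ m, centralizer ((⊤ : Subgroup G).lowerCentralSeries r : Set G) ≤
      Subgroup.upperCentralSeries G m := by
  set L : Subgroup G := (⊤ : Subgroup G).lowerCentralSeries r with hL
  set H : Subgroup G := centralizer (L : Set G) with hH
  obtain ⟨s, hs⟩ := exists_le_upperCentralSeries_of_centralizes hG hF r (H ⊓ L)
    (inf_le_left.trans (centralizer_le inf_le_right)) inf_le_left
  have hdown : ∀ t ≤ r, H ⊓ (⊤ : Subgroup G).lowerCentralSeries (r - t) ≤
      Subgroup.upperCentralSeries G (s + t) := by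
    intro t
    induction t with
    | zero => exact fun _ => hs
    | succ t iht =>
      intro ht
      rw [← add_assoc, ← commutator_le_upperCentralSeries_iff]
      refine le_trans (le_inf ?_ ?_) (iht (by omega))
      · exact (commutator_mono inf_le_left le_rfl).trans (commutator_le_left _ _)
      · rw [show r - t = r - (t + 1) + 1 by omega]
        exact commutator_mono inf_le_right le_rfl
  refine ⟨s + r, le_trans (le_inf le_rfl ?_) (hdown r le_rfl)⟩
  simp

theorem isNilpotent_of_isLocallyNormalNilpotent (hG : IsMC G) (hF : IsLocallyNormalNilpotent G) :
    Group.IsNilpotent G := by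
  obtain ⟨r, hr⟩ := hG.exists_centralizer_stable (Subgroup.lowerCentralSeries_antitone (⊤ : Subgroup G))
  obtain ⟨m, hm⟩ := exists_centralizer_lowerCentralSeries_le hG hF r
  obtain ⟨N, hN, hN', hNC⟩ := exists_centralizer_lowerCentralSeries_eq hG hF (max r m)
  rw [hr _ (le_max_left r m)] at hNC
  rw [← hNC] at hm
  obtain ⟨c, hc⟩ := (isNilpotent_iff_lowerCentralSeries N).1 hN'
  -- Since `max r m ≥ m`, that term of `N` kills anything `N` moves into the `m`-th centre. With
  -- `hm`, such an `E` itself lies in that centre; this is used along the series of `N`, then for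
  -- `⊤`.
  have hcentral : ∀ E : Subgroup G, ⁅E, N⁆ ≤ Subgroup.upperCentralSeries G m →
      E ≤ centralizer (N.lowerCentralSeries (max r m) : Set G) := by
    intro E hE
    rw [← commutator_eq_bot_iff_le_centralizer, eq_bot_iff]
    refine (commutator_lowerCentralSeries_le hE _).trans ?_
    rw [Nat.sub_eq_zero_of_le (le_max_right r m), Subgroup.upperCentralSeries_zero]
  have hdown : ∀ t ≤ c, N.lowerCentralSeries (c - t) ≤
      centralizer (N.lowerCentralSeries (max r m) : Set G) := by
    intro t
    induction t with
    | zero => exact fun _ => by simp [hc]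
    | succ t iht =>
      intro ht
      refine hcentral _ (le_trans ?_ ((iht (by omega)).trans hm))
      rw [← Subgroup.lowerCentralSeries_succ, show c - (t + 1) + 1 = c - t by omega]
  have hNm : N ≤ Subgroup.upperCentralSeries G m := by
    simpa using (hdown c le_rfl).trans hm
  refine ⟨m, eq_top_iff.2 (le_trans (hcentral ⊤ ?_) hm)⟩
  exact (commutator_le_right _ _).trans hNm

end LocallyNormalNilpotent

/-- The Fitting subgroup of a group with the chain condition on centralizers is nilpotent. -/
theorem isNilpotent_fitting {G : Type*} [Group G] (hG : IsMC G) :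
    Group.IsNilpotent (fitting G) :=
  isNilpotent_of_isLocallyNormalNilpotent (hG.subgroup _) isLocallyNormalNilpotent_fitting

end MCGroup
namespace MCGroup

/-! ### Membership in F(G) through commutators of conjugates. -/

section IteratedCommutators

variable {G : Type*} [Group G]

/-- The left-normed commutator of `g` with its conjugates by the entries of a list. -/
def conjCommutator (g : G) : List G → G
  | [] => g
  | x :: l => ⁅conjCommutator g l, x * g * x⁻¹⁆

theorem conjCommutator_mem_lowerCentralSeries {N : Subgroup G} [N.Normal] {g : G} (hg : g ∈ N)
    (l : List G) : conjCommutator g l ∈ N.lowerCentralSeries l.length := by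
  induction l with
  | nil => exact hg
  | cons x l ih => exact commutator_mem_commutator ih (Normal.conj_mem inferInstance g hg x)

theorem lowerCentralSeries_normalClosure_le (g : G) (k : ℕ) :
    (normalClosure {g}).lowerCentralSeries k ≤
      normalClosure {c | ∃ l : List G, l.length = k ∧ conjCommutator g l = c} := by
  induction k with
  | zero =>
    refine normalClosure_mono ?_
    rintro _ rfl
    exact ⟨[], rfl, rfl⟩
  | succ k ih =>
    set W := normalClosure {c | ∃ l : List G, l.length = k + 1 ∧ conjCommutator g l = c}
    refine (commutator_mono ih le_rfl).trans ?_
    rw [commutator_le_iff_le_comap_centralizer]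
    -- Normality of this image makes its centralizer normal, so testing the generators of the normal
    -- closure suffices.
    have : ((normalClosure {g}).map (QuotientGroup.mk' W)).Normal :=
      Normal.map inferInstance _ (QuotientGroup.mk'_surjective W)
    refine normalClosure_le_normal ?_
    rintro _ ⟨l, hl, rfl⟩
    rw [SetLike.mem_coe, mem_comap, normalClosure, MonoidHom.map_closure, centralizer_closure,
      mem_centralizer_iff_commutator_eq_one']
    rintro _ ⟨y, hy, rfl⟩
    obtain ⟨g', rfl, hgy⟩ := Group.mem_conjugatesOfSet_iff.1 hy
    obtain ⟨x, rfl⟩ := isConj_iff.1 hgy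
    rw [← map_commutatorElement, ← MonoidHom.mem_ker, QuotientGroup.ker_mk']
    exact subset_normalClosure ⟨x :: l, by simp [hl], rfl⟩

theorem mem_fitting_of_conjCommutator_eq_one {g : G} {n : ℕ}
    (h : ∀ l : List G, l.length = n → conjCommutator g l = 1) : g ∈ fitting G := by
  refine mem_fitting_iff.2 ⟨normalClosure {g}, inferInstance, ?_, subset_normalClosure rfl⟩
  refine isNilpotent_of_lowerCentralSeries_eq_bot (n := n) (eq_bot_iff.2 ?_)
  refine (lowerCentralSeries_normalClosure_le g n).trans (normalClosure_le_normal ?_)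
  rintro _ ⟨l, hl, rfl⟩
  exact h l hl

theorem mem_fitting_iff_conjCommutator {n : ℕ} (hn : (fitting G).lowerCentralSeries n = ⊥)
    {g : G} : g ∈ fitting G ↔ ∀ l : List G, l.length = n → conjCommutator g l = 1 := by
  refine ⟨fun hg l hl => ?_, mem_fitting_of_conjCommutator_eq_one⟩
  have := conjCommutator_mem_lowerCentralSeries hg l
  rwa [hl, hn, mem_bot] at this

end IteratedCommutators

/-! ### First-order formulas for F(G). -/

section Formulas

open FirstOrder Language

variable {α : Type} {G : Type*} [Group G]

/-- The product of two terms. -/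
def mulTerm (s t : groupLang.Term α) : groupLang.Term α :=
  Term.func (L := groupLang) GroupFunc.mul ![s, t]

/-- The inverse of a term. -/
def invTerm (t : groupLang.Term α) : groupLang.Term α :=
  Term.func (L := groupLang) GroupFunc.inv ![t]

/-- The identity as a term. -/
def oneTerm : groupLang.Term α :=
  Term.func (L := groupLang) GroupFunc.one ![]

@[simp]
theorem realize_mulTerm (s t : groupLang.Term α) (w : α → G) :
    (mulTerm s t).realize w = s.realize w * t.realize w := rfl

@[simp]
theorem realize_invTerm (t : groupLang.Term α) (w : α → G) :
    (invTerm t).realize w = (t.realize w)⁻¹ := rfl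

@[simp]
theorem realize_oneTerm (w : α → G) : (oneTerm : groupLang.Term α).realize w = 1 := rfl

/-- The term of which `conjCommutator` is the interpretation. -/
def conjCommutatorTerm (t : groupLang.Term α) : List (groupLang.Term α) → groupLang.Term α
  | [] => t
  | s :: l =>
    let c := conjCommutatorTerm t l
    let d := mulTerm (mulTerm s t) (invTerm s)
    mulTerm (mulTerm (mulTerm c d) (invTerm c)) (invTerm d)

theorem realize_conjCommutatorTerm (t : groupLang.Term α) (l : List (groupLang.Term α))
    (w : α → G) : (conjCommutatorTerm t l).realize w =
      conjCommutator (t.realize w) (l.map fun s => s.realize w) := by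
  induction l with
  | nil => rfl
  | cons s l ih => simp [conjCommutatorTerm, conjCommutator, ih, commutatorElement_def]

/-- The formula stating that all left-normed commutators of length `n + 1` in the conjugates of `x`
that begin with `x` are trivial. -/
noncomputable def fittingFormula (n : ℕ) : groupLang.Formula (Fin 1) :=
  Formula.iAlls (Fin n) <| Term.equal
    (conjCommutatorTerm (Term.var (Sum.inl 0)) (List.ofFn fun i => Term.var (Sum.inr i))) oneTerm

theorem realize_fittingFormula {n : ℕ} {w : Fin 1 → G} :
    (fittingFormula n).Realize w ↔
      ∀ l : List G, l.length = n → conjCommutator (w 0) l = 1 := by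
  simp only [fittingFormula, Formula.realize_iAlls, Formula.realize_equal,
    realize_conjCommutatorTerm, realize_oneTerm, List.map_ofFn, Function.comp_def,
    Term.realize_var, Sum.elim_inl, Sum.elim_inr]
  constructor
  · rintro h l rfl
    simpa using h l.get
  · exact fun h x => h _ (List.length_ofFn)

theorem mem_fitting_iff_realize {n : ℕ} (hn : (fitting G).lowerCentralSeries n = ⊥) (g : G) :
    g ∈ fitting G ↔ (fittingFormula n).Realize fun _ => g :=
  (mem_fitting_iff_conjCommutator hn).trans (realize_fittingFormula (w := fun _ => g)).symm

/-- The sentence stating that the `m`-th Fitting formula implies the `n`-th. -/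
noncomputable def fittingImpSentence (m n : ℕ) : groupLang.Sentence :=
  Formula.iAlls (α := Empty) (Fin 1)
    (Formula.relabel Sum.inr ((fittingFormula m).imp (fittingFormula n)))

theorem realize_fittingImpSentence {m n : ℕ} :
    Sentence.Realize G (fittingImpSentence m n) ↔
      ∀ g : G, ((fittingFormula m).Realize fun _ => g) → (fittingFormula n).Realize fun _ => g := by
  simp only [fittingImpSentence, Sentence.Realize, Formula.realize_iAlls, Formula.realize_relabel,
    Formula.realize_imp]
  constructor
  · exact fun h g => h fun _ => g
  · intro h i
    have hi : (fun a => Sum.elim (default : Empty → G) i a) ∘ Sum.inr = fun _ => i 0 := by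
      funext a
      rw [Subsingleton.elim a 0]
      rfl
    rw [hi]
    exact h (i 0)

end Formulas

/-! ### Centralizer chains in first-order terms. -/

section CentralizerDimension

open FirstOrder Language

variable {G : Type*} [Group G]

/-- There are elements `a i`, `b i` for `i < n` such that `b i` commutes with `a j` for `j < i`, but
not with `a i`. -/
def HasCentralizerChain (G : Type*) [Group G] (n : ℕ) : Prop :=
  ∃ a b : Fin n → G, ∀ i j, (i = j → b i * a j ≠ a j * b i) ∧ (j < i → b i * a j = a j * b i)

/-- The sentence of which `HasCentralizerChain` is the interpretation. -/
noncomputable def centralizerChainSentence (n : ℕ) : groupLang.Sentence :=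
  Formula.iExs (α := Empty) (Fin n ⊕ Fin n) <| Formula.iInf fun p : Fin n × Fin n =>
    let a : groupLang.Term (Empty ⊕ (Fin n ⊕ Fin n)) := Term.var (Sum.inr (Sum.inl p.2))
    let b : groupLang.Term (Empty ⊕ (Fin n ⊕ Fin n)) := Term.var (Sum.inr (Sum.inr p.1))
    let e : groupLang.Formula (Empty ⊕ (Fin n ⊕ Fin n)) := (mulTerm b a).equal (mulTerm a b)
    if p.1 = p.2 then e.not else if p.2 < p.1 then e else ⊤

theorem realize_centralizerChainSentence {n : ℕ} :
    Sentence.Realize G (centralizerChainSentence n) ↔ HasCentralizerChain G n := by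
  have key : ∀ a b : Fin n → G,
      (∀ p : Fin n × Fin n, Formula.Realize
        (let a : groupLang.Term (Empty ⊕ (Fin n ⊕ Fin n)) := Term.var (Sum.inr (Sum.inl p.2))
        let b : groupLang.Term (Empty ⊕ (Fin n ⊕ Fin n)) := Term.var (Sum.inr (Sum.inr p.1))
        let e : groupLang.Formula (Empty ⊕ (Fin n ⊕ Fin n)) := (mulTerm b a).equal (mulTerm a b)
        if p.1 = p.2 then e.not else if p.2 < p.1 then e else ⊤)
        (Sum.elim (default : Empty → G) (Sum.elim a b))) ↔
      ∀ i j, (i = j → b i * a j ≠ a j * b i) ∧ (j < i → b i * a j = a j * b i) := by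
    intro a b
    rw [Prod.forall]
    refine forall₂_congr fun i j => ?_
    dsimp only
    split_ifs with h₁ h₂
    · simp [Formula.realize_not, Formula.realize_equal, h₁]
    · simp [Formula.realize_equal, h₁, h₂]
    · simp [h₁, h₂]
  rw [centralizerChainSentence, Sentence.Realize, Formula.realize_iExs]
  simp only [Formula.realize_iInf]
  constructor
  · rintro ⟨i, hi⟩
    refine ⟨i ∘ Sum.inl, i ∘ Sum.inr, (key _ _).1 ?_⟩
    rwa [Sum.elim_comp_inl_inr]
  · rintro ⟨a, b, h⟩
    exact ⟨Sum.elim a b, (key a b).2 h⟩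

theorem HasFCD.exists_not_hasCentralizerChain (h : HasFCD G) :
    ∃ n, ¬ HasCentralizerChain G n := by
  obtain ⟨n, -, hn⟩ := h
  refine ⟨n + 1, ?_⟩
  rintro ⟨a, b, hab⟩
  -- The `i`-th set is 1 with the `a j` for `j < i`; `b i` witnesses the strict drop from `i` to `i
  -- + 1`.
  refine absurd (hn (n + 1) (fun i => insert 1 {x | ∃ j : Fin (n + 1), j.castSucc < i ∧ a j = x})
    ?_ ?_) (by omega)
  · simp
  · rw [Fin.strictAnti_iff_succ_lt]
    intro i
    refine SetLike.lt_iff_le_and_exists.2 ⟨centralizer_le (Set.insert_subset_insert ?_), b i, ?_, ?_⟩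
    · rintro _ ⟨j, hj, rfl⟩
      exact ⟨j, hj.trans i.castSucc_lt_succ, rfl⟩
    · rw [mem_centralizer_iff]
      rintro _ (rfl | ⟨j, hj, rfl⟩)
      · simp
      · exact ((hab i j).2 (Fin.castSucc_lt_castSucc_iff.1 hj)).symm
    · intro hmem
      exact (hab i i).1 rfl (mem_centralizer_iff.1 hmem (a i)
        (Set.mem_insert_of_mem _ ⟨i, i.castSucc_lt_succ, rfl⟩)).symm

theorem isMC_of_not_hasCentralizerChain {n : ℕ} (h : ¬ HasCentralizerChain G n) : IsMC G := by
  rintro ⟨A, hA⟩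
  have hanti : Antitone fun n => centralizer (A n) := antitone_nat_of_succ_le fun n => (hA n).le
  choose b hb hb' using fun n => SetLike.exists_of_lt (hA n)
  have hex : ∀ n, ∃ a ∈ A (n + 1), b n * a ≠ a * b n := fun n => by
    have := hb' n
    rw [mem_centralizer_iff] at this
    push Not at this
    obtain ⟨a, ha, hne⟩ := this
    exact ⟨a, ha, hne.symm⟩
  choose a ha hne using hex
  refine h ⟨fun i => a i, fun i => b i, fun i j => ⟨?_, fun hji => ?_⟩⟩
  · rintro rfl
    exact hne i
  · exact (hanti (Nat.succ_le_of_lt hji) (hb i) (a j) (ha j)).symm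

end CentralizerDimension

end MCGroup

theorem mainTheorem4 (G : Type u) [Group G] (hG : MCGroup.IsMC G) :
    (∃ D : Subgroup G, (∅ : Set G).Definable₁ MCGroup.groupLang (D : Set G) ∧
      Group.IsNilpotent D ∧ MCGroup.fitting G = D) ∧
    (MCGroup.HasFCD G →
      ∃ φ : MCGroup.groupLang.Formula (Fin 1),
        (∀ g : G, g ∈ MCGroup.fitting G ↔ φ.Realize (fun _ => g)) ∧
        ∀ (G' : Type v) [Group G'],
          FirstOrder.Language.Theory.Model G' (MCGroup.groupLang.completeTheory G) →
            ∀ g : G', g ∈ MCGroup.fitting G' ↔ φ.Realize (fun _ => g)) := by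
  have hnil := MCGroup.isNilpotent_fitting hG
  obtain ⟨n, hn⟩ := (Subgroup.isNilpotent_iff_lowerCentralSeries _).1 hnil
  refine ⟨⟨MCGroup.fitting G, ?_, hnil, rfl⟩, fun hfcd => ⟨MCGroup.fittingFormula n,
    MCGroup.mem_fitting_iff_realize hn, fun G' _ hG' g => ?_⟩⟩
  · refine Set.empty_definable_iff.2 ⟨MCGroup.fittingFormula n, Set.ext fun x => ?_⟩
    have hx : x = fun _ => x 0 := funext fun i => by rw [Subsingleton.elim i 0]
    rw [hx]
    exact MCGroup.mem_fitting_iff_realize hn (x 0)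
  · obtain ⟨N, hN⟩ := hfcd.exists_not_hasCentralizerChain
    have hMC : MCGroup.IsMC G' := MCGroup.isMC_of_not_hasCentralizerChain (n := N) (by
      rwa [← MCGroup.realize_centralizerChainSentence,
        FirstOrder.Language.realize_iff_of_model_completeTheory G G',
        MCGroup.realize_centralizerChainSentence])
    obtain ⟨m, hm⟩ := (Subgroup.isNilpotent_iff_lowerCentralSeries _).1
      (MCGroup.isNilpotent_fitting hMC)
    -- In `G` either formula forces membership in F(G), so the implication holds there and transfers
    -- to `G'`.
    have himp : ∀ g : G', ((MCGroup.fittingFormula (max m n)).Realize fun _ => g) →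
        (MCGroup.fittingFormula n).Realize fun _ => g := by
      rw [← MCGroup.realize_fittingImpSentence,
        FirstOrder.Language.realize_iff_of_model_completeTheory G G',
        MCGroup.realize_fittingImpSentence]
      intro g hg
      rw [← MCGroup.mem_fitting_iff_realize hn]
      exact MCGroup.mem_fitting_of_conjCommutator_eq_one (MCGroup.realize_fittingFormula.1 hg)
    constructor
    · intro hg
      refine himp g ((MCGroup.mem_fitting_iff_realize (eq_bot_iff.2 ?_) g).1 hg)
      exact ((MCGroup.fitting G').lowerCentralSeries_antitone (le_max_left m n)).trans hm.le
    · exact fun hg =>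
        MCGroup.mem_fitting_of_conjCommutator_eq_one (MCGroup.realize_fittingFormula.1 hg)
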